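/- Let $k$ be an algebraically closed field and let $\mathcal{C}$ be a $k$-linear triangulated category with split idempotents and suspension functor $\Sigma$. Assume that $\mathcal{C}$ is Hom-finite (all spaces $\mathcal{C}(X,Y)$ are finite-dimensional over $k$) and $2$-Calabi--Yau, i.e. there are $k$-linear isomorphisms $\mathcal{C}(X,\Sigma Y)\simeq \operatorname{Hom}_k(\mathcal{C}(Y,\Sigma X),k)$, natural in $X$ and $Y$. Let $T$ be a cluster-tilting object of $\mathcal{C}$: $\mathcal{C}(T,\Sigma T)=0$, and every object $X$ with $\mathcal{C}(X,\Sigma T)=0$ is a direct summand of a finite direct sum of copies of $T$. Let $B=\operatorname{End}_{\mathcal{C}}(T)$ and let $\operatorname{mod}B$ be the category of finite-dimensional right $B$-modules. Let $\mathrm{K}_0^{\mathrm{sp}}(\operatorname{mod}B)$ (resp. $\mathrm{K}_0(\operatorname{mod}B)$) be the quotient of the free abelian group on the isomorphism classes $[N]$ of finite-dimensional right $B$-modules by the subgroup generated by all $[N_1\oplus N_2]-[N_1]-[N_2]$ (resp. by all $[Y]-[X]-[Z]$ for short exact sequences $0\to X\to Y\to Z\to 0$ in $\operatorname{mod}B$),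 and let $\pi:\mathrm{K}_0^{\mathrm{sp}}(\operatorname{mod}B)\to \mathrm{K}_0(\operatorname{mod}B)$ be the canonical surjection. Let $\langle\;,\;\rangle$ be the bilinear form on $\mathrm{K}_0^{\mathrm{sp}}(\operatorname{mod}B)$ with $$\langle [N],[N']\rangle=\dim_k\operatorname{Hom}_B(N,N')-\dim_k\operatorname{Ext}^1_B(N,N'),$$ and put $\langle x,y\rangle_a=\langle x,y\rangle-\langle y,x\rangle$. Then the antisymmetric bilinear form $\langle\;,\;\rangle_a$ descends to $\mathrm{K}_0(\operatorname{mod}B)$: there is a unique bilinear form $\beta:\mathrm{K}_0(\operatorname{mod}B)\times \mathrm{K}_0(\operatorname{mod}B)\to\mathbb{Z}$ such that $\beta(\pi x,\pi y)=\langle x,y\rangle_a$ for all $x,y\in\mathrm{K}_0^{\mathrm{sp}}(\operatorname{mod}B)$, and $\beta$ is antisymmetric. In particular, for every indecomposable direct summand $T_i$ of $T$, with $S_i$ the top of the right $B$-module $\mathcal{C}(T,T_i)$, the linear form $\langle [S_i],?\rangle_a$ induces a well-defined linear form on $\mathrm{K}_0(\operatorname{mod}B)$, i.e. there is a unique homomorphism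 $\ell_i:\mathrm{K}_0(\operatorname{mod}B)\to\mathbb{Z}$ with $\ell_i(\pi y)=\langle [S_i],y\rangle_a$ for all $y$. -/

import Mathlib

open CategoryTheory CategoryTheory.Limits CategoryTheory.Abelian
open scoped ModuleCat

universe w v u

noncomputable section

namespace TwoCY

/-! ### Finite-dimensional right modules over a `k`-algebra and their Grothendieck groups -/

section Modules

variable (k : Type w) [Field k] (B : Type v) [Ring B] [Algebra k B]

/-- Right `B`-modules are modules over `Bᵐᵒᵖ`; this is the property of having finite
dimension over `k` (acting through `k → B`). -/
def isFD : ObjectProperty (ModuleCat.{v} Bᵐᵒᵖ) := fun M => Module.Finite k M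

/-- The category `mod B` of finite-dimensional right `B`-modules. -/
abbrev FDMod : Type (v + 1) := (isFD k B).FullSubcategory

/-- Isomorphism classes of finite-dimensional right `B`-modules. -/
abbrev IsoClass : Type (v + 1) := Quotient (isIsomorphicSetoid (FDMod k B))

variable {k B}

instance finiteObj (N : FDMod k B) : Module.Finite k N.obj := N.property

/-- The generator attached to a module. -/
def cls (N : FDMod k B) : FreeAbelianGroup (IsoClass k B) :=
  FreeAbelianGroup.of (Quotient.mk (isIsomorphicSetoid (FDMod k B)) N)

lemma finite_of_surjective {M N : ModuleCat.{v} Bᵐᵒᵖ} [Module.Finite k M] (f : M ⟶ N)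
    (hf : Function.Surjective f.hom) : Module.Finite k N :=
  Module.Finite.of_surjective (f.hom.restrictScalars k) hf

lemma finite_of_injective {M N : ModuleCat.{v} Bᵐᵒᵖ} [hN : Module.Finite k N] (f : M ⟶ N)
    (hf : Function.Injective f.hom) : Module.Finite k M :=
  Module.Finite.of_injective (f.hom.restrictScalars k) hf

/-- The direct sum of two finite-dimensional modules. -/
def dsum (N₁ N₂ : FDMod k B) : FDMod k B where
  obj := N₁.obj ⊞ N₂.obj
  property := by
    let φ : (N₁.obj ⊞ N₂.obj : ModuleCat.{v} Bᵐᵒᵖ) →ₗ[k] (N₁.obj × N₂.obj) :=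
      ((biprod.fst : N₁.obj ⊞ N₂.obj ⟶ N₁.obj).hom.restrictScalars k).prod
        ((biprod.snd : N₁.obj ⊞ N₂.obj ⟶ N₂.obj).hom.restrictScalars k)
    refine Module.Finite.of_injective φ ?_
    rw [injective_iff_map_eq_zero]
    intro x hx
    have h1 : (biprod.fst : N₁.obj ⊞ N₂.obj ⟶ N₁.obj).hom x = 0 := congrArg Prod.fst hx
    have h2 : (biprod.snd : N₁.obj ⊞ N₂.obj ⟶ N₂.obj).hom x = 0 := congrArg Prod.snd hx
    have h := congrArg (fun f => f.hom x) (biprod.total (X := N₁.obj) (Y := N₂.obj))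
    simp only [ModuleCat.hom_add, ModuleCat.hom_comp, LinearMap.add_apply,
      LinearMap.comp_apply, ModuleCat.hom_id, LinearMap.id_apply] at h
    rw [h1, h2, map_zero, map_zero, add_zero] at h
    exact h.symm

variable (k B)

/-- The elements `[N₁ ⊕ N₂] - [N₁] - [N₂]`. -/
def splitRel : Set (FreeAbelianGroup (IsoClass k B)) :=
  {x | ∃ N₁ N₂ : FDMod k B, x = cls (dsum N₁ N₂) - cls N₁ - cls N₂}

/-- The elements `[Y] - [X] - [Z]` for all short exact sequences `0 → X → Y → Z → 0`. -/
def exactRel : Set (FreeAbelianGroup (IsoClass k B)) :=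
  {x | ∃ (X Y Z : FDMod k B) (f : X.obj ⟶ Y.obj) (g : Y.obj ⟶ Z.obj) (h : f ≫ g = 0),
    (ShortComplex.mk f g h).ShortExact ∧ x = cls Y - cls X - cls Z}

/-- The split Grothendieck group of `mod B`. -/
abbrev K0sp : Type (v + 1) :=
  FreeAbelianGroup (IsoClass k B) ⧸ AddSubgroup.closure (splitRel k B)

/-- The Grothendieck group of `mod B`. -/
abbrev K0 : Type (v + 1) :=
  FreeAbelianGroup (IsoClass k B) ⧸ AddSubgroup.closure (exactRel k B)

lemma splitRel_subset_exactRel : splitRel k B ⊆ exactRel k B := by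
  rintro x ⟨N₁, N₂, rfl⟩
  exact ⟨N₁, dsum N₁ N₂, N₂, biprod.inl, biprod.snd, biprod.inl_snd,
    (ShortComplex.Splitting.ofHasBinaryBiproduct N₁.obj N₂.obj).shortExact, rfl⟩

/-- The canonical surjection from the split Grothendieck group to the Grothendieck group. -/
def toK0 : K0sp k B →+ K0 k B :=
  QuotientAddGroup.map _ _ (AddMonoidHom.id _)
    (AddSubgroup.closure_mono (splitRel_subset_exactRel k B))

variable {k B}

/-- The class of a module in the split Grothendieck group. -/
def K0sp.mk (N : FDMod k B) : K0sp k B := QuotientAddGroup.mk (cls N)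

/-- The universal property of the split Grothendieck group. -/
def K0sp.lift {A : Type*} [AddCommGroup A] (f : FDMod k B → A)
    (hiso : ∀ M N : FDMod k B, Nonempty (M ≅ N) → f M = f N)
    (hadd : ∀ M N : FDMod k B, f (dsum M N) = f M + f N) : K0sp k B →+ A :=
  QuotientAddGroup.lift _
    (FreeAbelianGroup.lift
      (Quotient.lift (s := isIsomorphicSetoid (FDMod k B)) f hiso)) (by
    rw [AddSubgroup.closure_le]
    rintro x ⟨N₁, N₂, rfl⟩
    have h : f (dsum N₁ N₂) - f N₁ - f N₂ = 0 := by
      rw [hadd]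
      abel
    rw [SetLike.mem_coe, AddMonoidHom.mem_ker]
    simp only [cls, map_sub, FreeAbelianGroup.lift_apply_of]
    exact h)

lemma K0sp.lift_mk {A : Type*} [AddCommGroup A] (f : FDMod k B → A)
    (hiso : ∀ M N : FDMod k B, Nonempty (M ≅ N) → f M = f N)
    (hadd : ∀ M N : FDMod k B, f (dsum M N) = f M + f N) (N : FDMod k B) :
    K0sp.lift f hiso hadd (K0sp.mk N) = f N := by
  simp only [K0sp.lift, K0sp.mk, cls, QuotientAddGroup.lift_mk, FreeAbelianGroup.lift_apply_of]
  rfl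

lemma K0sp.hom_ext {A : Type*} [AddCommGroup A] {f g : K0sp k B →+ A}
    (h : ∀ N, f (K0sp.mk N) = g (K0sp.mk N)) : f = g := by
  apply QuotientAddGroup.addMonoidHom_ext
  apply FreeAbelianGroup.lift_ext
  rintro ⟨N⟩
  exact h N

/-! ### The form `dim Hom - dim Ext¹` -/

instance finiteHom (M N : FDMod k B) : Module.Finite k (M.obj ⟶ N.obj) := by
  let φ : (M.obj ⟶ N.obj) →ₗ[k] (M.obj →ₗ[k] N.obj) :=
    { toFun := fun f => f.hom.restrictScalars k
      map_add' := fun _ _ => rfl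
      map_smul' := fun _ _ => rfl }
  refine Module.Finite.of_injective φ ?_
  intro f g h
  ext x
  exact LinearMap.congr_fun h x

instance finiteExtZero (M N : FDMod k B) : Module.Finite k (Ext M.obj N.obj 0) :=
  Module.Finite.equiv (Ext.linearEquiv₀ (R := k) (X := M.obj) (Y := N.obj)).symm

lemma isFD_of_finite [Module.Finite k B] (M : ModuleCat.{v} Bᵐᵒᵖ)
    (_ : Module.Finite Bᵐᵒᵖ M) : isFD k B M := by
  have : Module.Finite k Bᵐᵒᵖ := Module.Finite.equiv (MulOpposite.opLinearEquiv k)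
  exact Module.Finite.trans Bᵐᵒᵖ M

instance finiteExt [Module.Finite k B] (M N : FDMod k B) :
    Module.Finite k (Ext M.obj N.obj 1) := by
  have : Module.Finite Bᵐᵒᵖ M.obj := Module.Finite.of_restrictScalars_finite k _ _
  obtain ⟨n, p, hp⟩ := Module.Finite.exists_fin' Bᵐᵒᵖ M.obj
  let P : ModuleCat.{v} Bᵐᵒᵖ := ModuleCat.of Bᵐᵒᵖ (Fin n → Bᵐᵒᵖ)
  have hP : Module.Finite Bᵐᵒᵖ P := inferInstanceAs (Module.Finite Bᵐᵒᵖ (Fin n → Bᵐᵒᵖ))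
  have : Projective P := ModuleCat.projective_of_free (Pi.basisFun Bᵐᵒᵖ (Fin n))
  let q : P ⟶ M.obj := ModuleCat.ofHom p
  have : Epi q := (ModuleCat.epi_iff_surjective q).2 hp
  let S := ShortComplex.mk _ _ (kernel.condition q)
  have hS : S.ShortExact :=
    { exact := ShortComplex.exact_of_f_is_kernel _ (kernelIsKernel q) }
  let K : FDMod k B := ⟨kernel q,
    finite_of_injective (hN := isFD_of_finite P hP) (kernel.ι q)
      ((ModuleCat.mono_iff_injective _).1 inferInstance)⟩
  have : Module.Finite k (Ext K.obj N.obj 0) := finiteExtZero K N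
  refine Module.Finite.of_surjective
    (Ext.precompOfLinear hS.extClass k N.obj (a := 0) (b := 1) rfl) ?_
  intro x
  exact Ext.contravariant_sequence_exact₃ hS N.obj x (Ext.eq_zero_of_projective _) rfl

/-- `⟨N, N'⟩ = dim Hom_B(N, N') - dim Ext¹_B(N, N')`. -/
def pairing (N N' : FDMod k B) : ℤ :=
  (Module.finrank k (N.obj ⟶ N'.obj) : ℤ) - (Module.finrank k (Ext N.obj N'.obj 1) : ℤ)

lemma finrank_ext_dsum_left (n : ℕ) (M₁ M₂ N : FDMod k B)
    [Module.Finite k (Ext M₁.obj N.obj n)] [Module.Finite k (Ext M₂.obj N.obj n)] :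
    Module.finrank k (Ext (dsum M₁ M₂).obj N.obj n) =
      Module.finrank k (Ext M₁.obj N.obj n) + Module.finrank k (Ext M₂.obj N.obj n) := by
  rw [← Module.finrank_prod]
  exact LinearEquiv.finrank_eq
    { (Ext.biprodAddEquiv : Ext (M₁.obj ⊞ M₂.obj) N.obj n ≃+ _) with
      map_smul' := fun r x => Prod.ext
        (Ext.comp_smul _ _ (zero_add n) _) (Ext.comp_smul _ _ (zero_add n) _) }

lemma finrank_ext_dsum_right (n : ℕ) (M N₁ N₂ : FDMod k B)
    [Module.Finite k (Ext M.obj N₁.obj n)] [Module.Finite k (Ext M.obj N₂.obj n)] :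
    Module.finrank k (Ext M.obj (dsum N₁ N₂).obj n) =
      Module.finrank k (Ext M.obj N₁.obj n) + Module.finrank k (Ext M.obj N₂.obj n) := by
  rw [← Module.finrank_prod]
  exact LinearEquiv.finrank_eq
    { (Ext.addEquivBiprod : Ext M.obj (N₁.obj ⊞ N₂.obj) n ≃+ _) with
      map_smul' := fun r x => Prod.ext
        (Ext.smul_comp _ _ (add_zero n) _) (Ext.smul_comp _ _ (add_zero n) _) }

lemma pairing_eq (N N' : FDMod k B) :
    pairing N N' = (Module.finrank k (Ext N.obj N'.obj 0) : ℤ) -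
      (Module.finrank k (Ext N.obj N'.obj 1) : ℤ) := by
  rw [pairing, (Ext.linearEquiv₀ (R := k) (X := N.obj) (Y := N'.obj)).finrank_eq]

lemma finrank_ext_congr (n : ℕ) {M M' N N' : FDMod k B} (e : M ≅ M') (e' : N ≅ N') :
    Module.finrank k (Ext M.obj N.obj n) = Module.finrank k (Ext M'.obj N'.obj n) := by
  have a : M.obj ≅ M'.obj := (isFD k B).ι.mapIso e
  have b : N.obj ≅ N'.obj := (isFD k B).ι.mapIso e'
  refine LinearEquiv.finrank_eq (LinearEquiv.ofLinearMap
    (Ext.precompOfLinear (Ext.mk₀ a.inv) k N'.obj (zero_add n) ∘ₗ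
      Ext.postcompOfLinear (Ext.mk₀ b.hom) k M.obj (add_zero n))
    (Ext.precompOfLinear (Ext.mk₀ a.hom) k N.obj (zero_add n) ∘ₗ
      Ext.postcompOfLinear (Ext.mk₀ b.inv) k M'.obj (add_zero n)) ?_ ?_)
  · ext x
    simp
  · ext x
    simp

lemma pairing_congr {M M' N N' : FDMod k B} (e : M ≅ M') (e' : N ≅ N') :
    pairing M N = pairing M' N' := by
  rw [pairing_eq, pairing_eq, finrank_ext_congr 0 e e', finrank_ext_congr 1 e e']

variable (k B)

/-- The bilinear form `⟨ , ⟩` on the split Grothendieck group. -/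
def form [Module.Finite k B] : K0sp k B →+ K0sp k B →+ ℤ :=
  K0sp.lift
    (fun N => K0sp.lift (fun N' => pairing N N')
      (fun _ _ ⟨e⟩ => pairing_congr (Iso.refl _) e)
      (fun N₁ N₂ => by
        simp only [pairing_eq, finrank_ext_dsum_right]
        push_cast
        ring))
    (fun _ _ ⟨e⟩ => K0sp.hom_ext fun N => by
      simp only [K0sp.lift_mk]
      exact pairing_congr e (Iso.refl _))
    (fun M₁ M₂ => K0sp.hom_ext fun N => by
      simp only [K0sp.lift_mk, AddMonoidHom.add_apply, pairing_eq, finrank_ext_dsum_left]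
      push_cast
      ring)

/-- The antisymmetric bilinear form `⟨x, y⟩ₐ = ⟨x, y⟩ - ⟨y, x⟩` on the split Grothendieck
group. -/
def formA [Module.Finite k B] : K0sp k B →+ K0sp k B →+ ℤ :=
  form k B - (form k B).flip

variable {k B}

lemma formA_mk [Module.Finite k B] (N N' : FDMod k B) :
    formA k B (K0sp.mk N) (K0sp.mk N') = pairing N N' - pairing N' N := by
  simp [formA, form, K0sp.lift_mk]

/-- The top `M / rad M` of a module, `rad M` being the intersection of the maximal
submodules of `M`. -/
def top (M : FDMod k B) : FDMod k B where
  obj := ModuleCat.of Bᵐᵒᵖ (M.obj ⧸ Module.jacobson Bᵐᵒᵖ M.obj)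
  property := finite_of_surjective
    (ModuleCat.ofHom (Module.jacobson Bᵐᵒᵖ M.obj).mkQ) (Submodule.mkQ_surjective _)

end Modules

/-! ### 2-Calabi--Yau triangulated categories and cluster-tilting objects -/

section Category

variable (k : Type w) [Field k] {C : Type u} [Category.{v} C] [Preadditive C] [Linear k C]

section

variable [HasShift C ℤ]

variable (C) in
/-- There are isomorphisms `C(X, ΣY) ≃ D C(Y, ΣX)`, natural in both `X` and `Y`. -/
def IsTwoCalabiYau : Prop :=
  ∃ φ : ∀ X Y : C, (X ⟶ Y⟦(1 : ℤ)⟧) ≃ₗ[k] Module.Dual k (Y ⟶ X⟦(1 : ℤ)⟧),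
    ∀ {X X' Y Y' : C} (f : X' ⟶ X) (h : Y ⟶ Y') (a : X ⟶ Y⟦(1 : ℤ)⟧)
      (b : Y' ⟶ X'⟦(1 : ℤ)⟧),
      φ X' Y' (f ≫ a ≫ h⟦(1 : ℤ)⟧') b = φ X Y a (h ≫ b ≫ f⟦(1 : ℤ)⟧')

/-- `X` is a direct summand of `Y`. -/
def IsSummand [HasBinaryBiproducts C] (X Y : C) : Prop :=
  ∃ Z : C, Nonempty (Y ≅ X ⊞ Z)

/-- `X` lies in `add T`: it is a direct summand of a finite direct sum of copies of `T`. -/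
def InAdd [HasBinaryBiproducts C] [HasFiniteBiproducts C] (T X : C) : Prop :=
  ∃ n : ℕ, IsSummand X (⨁ fun _ : Fin n => T)

/-- `T` is a cluster-tilting object. -/
structure IsClusterTilting [HasBinaryBiproducts C] [HasFiniteBiproducts C] (T : C) : Prop where
  rigid : ∀ f : T ⟶ T⟦(1 : ℤ)⟧, f = 0
  mem_add : ∀ X : C, (∀ f : X ⟶ T⟦(1 : ℤ)⟧, f = 0) → InAdd T X

end

variable [∀ X Y : C, Module.Finite k (X ⟶ Y)]

instance finiteEnd (T : C) : Module.Finite k (End T) :=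
  inferInstanceAs (Module.Finite k (T ⟶ T))

/-- The right `End T`-module `F X = C(T, X)`, with `End T` acting by precomposition. -/
def F (T X : C) : FDMod k (End T) where
  obj := (preadditiveCoyonedaObj T).obj X
  property := by
    let φ : (T ⟶ X) →ₗ[k] (preadditiveCoyonedaObj T).obj X :=
      { toFun := fun f => f
        map_add' := fun _ _ => rfl
        map_smul' := fun r f => by
          change r • f = (r • 𝟙 T) ≫ f
          rw [Linear.smul_comp, Category.id_comp] }
    exact Module.Finite.of_surjective φ fun f => ⟨f, rfl⟩

end Category

end TwoCY

end

/-!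
Put `F = C(T, -)` and let `ghost_U(X, Y)` be the space of the morphisms `X ⟶ Y` killed by `C(U, -)`.
Every `X` sits in a triangle `P₁ ⟶ P₀ ⟶ X ⟶ ΣP₁` with `Pᵢ ∈ add T`, which yields
`dim Hom(FX, FY) = dim C(X, Y) - dim ghost_T(X, Y)` and
`dim Ext¹(FX, FY) = dim (ghost_T ∩ ghost_ΣT)(X, ΣY)`. The Calabi-Yau duality makes `ghost_U(X, ΣY)`
and `ghost_U(Y, ΣX)` orthogonal complements of each other for `U = T` and `U = ΣT`; hence it turns
the intersection in `Ext¹(FY, FX)` into a sum, and the two `Ext¹` terms of `⟨FX, FY⟩ₐ` combine by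
the modular law. Since `ghost_ΣT(ΣX, ΣY) ≃ ghost_T(X, Y)`, the Euler characteristics of the long
exact sequences of the triangles of `ΣX` and `X` give
`⟨FΣX, FY⟩ₐ = ⟨ind ΣX, FY⟩ + ⟨ind X, FY⟩`,
where `ind X = [P₀] - [P₁]` and `⟨[P], M⟩ = dim Hom(FP, M)`. The right-hand side is exact in `FY`
because `FPᵢ` is projective, and every finite-dimensional module is of the form `FΣX` and of the
form `FY`.
-/

noncomputable section

namespace TwoCY

open Pretriangulated

section LinearAlgebra

variable {k V W : Type*} [Field k] [AddCommGroup V] [Module k V] [AddCommGroup W] [Module k W]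

lemma finrank_add_finrank_dualCoannihilator_map [Module.Finite k W]
    (φ : V ≃ₗ[k] Module.Dual k W) (A : Submodule k V) :
    Module.finrank k A + Module.finrank k (A.map φ.toLinearMap).dualCoannihilator =
      Module.finrank k V := by
  rw [φ.finrank_eq, Subspace.dual_finrank_eq, (φ.submoduleMap A).finrank_eq]
  exact Subspace.finrank_add_finrank_dualCoannihilator_eq (A.map φ.toLinearMap)

lemma finrank_map_add_finrank_ker [Module.Finite k V] (L : V →ₗ[k] W) {A : Submodule k V}
    (hA : LinearMap.ker L ≤ A) :
    Module.finrank k (A.map L) + Module.finrank k (LinearMap.ker L) = Module.finrank k A := by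
  rw [← (L.domRestrict A).finrank_range_add_finrank_ker, LinearMap.range_domRestrict,
    LinearMap.ker_domRestrict, (Submodule.comapSubtypeEquivOfLe hA).finrank_eq]

end LinearAlgebra

section Descent

variable {k : Type w} [Field k] {B : Type v} [Ring B] [Algebra k B] {A : Type*} [AddCommGroup A]

/-- Additivity on short exact sequences of a homomorphism out of the split Grothendieck group. -/
def IsExactAdditive (l : K0sp k B →+ A) : Prop :=
  ∀ {X Y Z : FDMod k B} {f : X.obj ⟶ Y.obj} {g : Y.obj ⟶ Z.obj} {h : f ≫ g = 0},
    (ShortComplex.mk f g h).ShortExact → l (K0sp.mk Y) = l (K0sp.mk X) + l (K0sp.mk Z)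

lemma toK0_surjective : Function.Surjective (toK0 k B) :=
  QuotientAddGroup.map_surjective_of_surjective _ _ _ (QuotientAddGroup.mk_surjective) _

lemma K0.hom_ext {l l' : K0 k B →+ A} (h : ∀ x, l (toK0 k B x) = l' (toK0 k B x)) : l = l' :=
  (AddMonoidHom.cancel_right toK0_surjective).1 (AddMonoidHom.ext h)

/-- The universal property of the Grothendieck group, relative to the split one. -/
def K0.lift (l : K0sp k B →+ A) (hl : IsExactAdditive l) : K0 k B →+ A :=
  QuotientAddGroup.lift _ (l.comp (QuotientAddGroup.mk' _)) <| by
    rw [AddSubgroup.closure_le]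
    rintro _ ⟨X, Y, Z, f, g, h, hS, rfl⟩
    have hl : l (K0sp.mk Y) - l (K0sp.mk X) - l (K0sp.mk Z) = 0 := by rw [hl hS]; abel
    rw [SetLike.mem_coe, AddMonoidHom.mem_ker, map_sub, map_sub]
    exact hl

lemma K0.lift_toK0 (l : K0sp k B →+ A) (hl : IsExactAdditive l) (x : K0sp k B) :
    K0.lift l hl (toK0 k B x) = l x := by
  obtain ⟨x, rfl⟩ := QuotientAddGroup.mk_surjective x
  rfl

lemma IsExactAdditive.K0_lift_flip {b : K0sp k B →+ K0sp k B →+ A} (hb : IsExactAdditive b)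
    (hb' : IsExactAdditive b.flip) : IsExactAdditive (K0.lift b hb).flip := fun hS =>
  K0.hom_ext fun x => by
    simpa only [AddMonoidHom.add_apply, AddMonoidHom.flip_apply, K0.lift_toK0] using
      DFunLike.congr_fun (hb' hS) x

/-- The bilinear form on the Grothendieck group induced by a bilinear form on the split one that
is exact in each variable. -/
def K0.lift₂ (b : K0sp k B →+ K0sp k B →+ A) (hb : IsExactAdditive b)
    (hb' : IsExactAdditive b.flip) : K0 k B →+ K0 k B →+ A :=
  (K0.lift (K0.lift b hb).flip (hb.K0_lift_flip hb')).flip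

lemma K0.lift₂_toK0 (b : K0sp k B →+ K0sp k B →+ A) (hb : IsExactAdditive b)
    (hb' : IsExactAdditive b.flip) (x y : K0sp k B) :
    K0.lift₂ b hb hb' (toK0 k B x) (toK0 k B y) = b x y := by
  change (K0.lift (K0.lift b hb).flip (hb.K0_lift_flip hb') (toK0 k B y)) (toK0 k B x) = b x y
  rw [K0.lift_toK0, AddMonoidHom.flip_apply, K0.lift_toK0]

lemma K0.hom_ext₂ {β β' : K0 k B →+ K0 k B →+ A}
    (h : ∀ x y, β (toK0 k B x) (toK0 k B y) = β' (toK0 k B x) (toK0 k B y)) : β = β' :=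
  K0.hom_ext fun x => K0.hom_ext fun y => h x y

lemma formA_flip [Module.Finite k B] : (formA k B).flip = -formA k B := by
  ext x y
  simp [formA]

end Descent

section InAdd

variable {C : Type u} [Category.{v} C] [Preadditive C] [HasBinaryBiproducts C]
  [HasFiniteBiproducts C] {T P X Y : C}

lemma inAdd_biproduct (T : C) (n : ℕ) : InAdd T (⨁ fun _ : Fin n => T) :=
  ⟨n, _, ⟨isoBiprodZero (isZero_zero C)⟩⟩

lemma InAdd.of_iso (h : InAdd T X) (e : X ≅ Y) : InAdd T Y := by
  obtain ⟨n, Z, ⟨i⟩⟩ := h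
  exact ⟨n, Z, ⟨i ≪≫ biprod.mapIso e (Iso.refl Z)⟩⟩

lemma InAdd.map {D : Type*} [Category* D] [Preadditive D] [HasBinaryBiproducts D]
    [HasFiniteBiproducts D] (h : InAdd T X) (G : C ⥤ D) [G.Additive] :
    InAdd (G.obj T) (G.obj X) := by
  obtain ⟨n, Z, ⟨i⟩⟩ := h
  have := preservesBinaryBiproducts_of_preservesBiproducts G
  exact ⟨n, G.obj Z, ⟨(G.mapBiproduct _).symm ≪≫ G.mapIso i ≪≫ G.mapBiprod X Z⟩⟩

lemma InAdd.exists_sum_comp_eq_id (h : InAdd T X) :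
    ∃ (n : ℕ) (p : Fin n → (X ⟶ T)) (q : Fin n → (T ⟶ X)), ∑ i, p i ≫ q i = 𝟙 X := by
  obtain ⟨n, Z, ⟨e⟩⟩ := h
  let p (i : Fin n) : X ⟶ T := biprod.inl ≫ e.inv ≫ biproduct.π (fun _ : Fin n => T) i
  let q (i : Fin n) : T ⟶ X := biproduct.ι (fun _ : Fin n => T) i ≫ e.hom ≫ biprod.fst
  refine ⟨n, p, q, ?_⟩
  calc
    ∑ i, p i ≫ q i =
        biprod.inl ≫ e.inv ≫ (∑ i, biproduct.π (fun _ : Fin n => T) i ≫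
          biproduct.ι (fun _ : Fin n => T) i) ≫ e.hom ≫ biprod.fst := by
      simp only [p, q, Preadditive.comp_sum, Preadditive.sum_comp, Category.assoc]
    _ = 𝟙 X := by simp [biproduct.total]

lemma InAdd.projective (h : InAdd T X) [Projective T] : Projective X where
  factors f e _ := by
    obtain ⟨n, p, q, hpq⟩ := h.exists_sum_comp_eq_id
    refine ⟨∑ i, p i ≫ Projective.factorThru (q i ≫ f) e, ?_⟩
    simp only [Preadditive.sum_comp, Category.assoc, Projective.factorThru_comp]
    simp only [← Category.assoc, ← Preadditive.sum_comp, hpq, Category.id_comp]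

lemma InAdd.comp_eq_zero (h : InAdd T P) {a : X ⟶ Y} (ha : ∀ t : T ⟶ X, t ≫ a = 0)
    (s : P ⟶ X) : s ≫ a = 0 := by
  obtain ⟨n, p, q, hpq⟩ := h.exists_sum_comp_eq_id
  rw [← Category.id_comp (s ≫ a), ← hpq, Preadditive.sum_comp]
  refine Finset.sum_eq_zero fun i _ => ?_
  rw [Category.assoc, ← Category.assoc (q i), ha, comp_zero]

lemma InAdd.hom_eq_zero (h : InAdd T P) (hX : ∀ t : X ⟶ T, t = 0) (s : X ⟶ P) : s = 0 := by
  obtain ⟨n, p, q, hpq⟩ := h.exists_sum_comp_eq_id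
  rw [← Category.comp_id s, ← hpq, Preadditive.comp_sum]
  refine Finset.sum_eq_zero fun i _ => ?_
  rw [← Category.assoc, hX (s ≫ p i), zero_comp]

lemma IsClusterTilting.shift [HasShift C ℤ] [∀ n : ℤ, (shiftFunctor C n).Additive]
    (h : IsClusterTilting T) : IsClusterTilting (T⟦(1 : ℤ)⟧) where
  rigid f := by
    obtain ⟨g, rfl⟩ := (shiftFunctor C (1 : ℤ)).map_surjective f
    rw [h.rigid g, Functor.map_zero]
  mem_add X hX := by
    let e : (X⟦(-1 : ℤ)⟧)⟦(1 : ℤ)⟧ ≅ X := (shiftFunctorCompIsoId C (-1 : ℤ) 1 (by simp)).app X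
    have hX' : InAdd T (X⟦(-1 : ℤ)⟧) := h.mem_add _ fun f => by
      apply (shiftFunctor C (1 : ℤ)).map_injective
      rw [Functor.map_zero, ← cancel_epi e.inv, hX (e.inv ≫ _), comp_zero]
    exact (hX'.map (shiftFunctor C (1 : ℤ))).of_iso e

end InAdd

section HomFunctor

variable (k : Type w) [Field k] {C : Type u} [Category.{v} C] [Preadditive C] [Linear k C]
  {T X Y : C}

instance linear_preadditiveCoyonedaObj (T : C) : (preadditiveCoyonedaObj T).Linear k where
  map_smul f r := by
    ext t
    change (T ⟶ _) at t
    change t ≫ (r • f) = (r • 𝟙 T) ≫ t ≫ f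
    rw [Linear.comp_smul, Linear.smul_comp, Category.id_comp]

variable (T X Y) in
/-- The morphisms `X ⟶ Y` that are invisible to `T`, i.e. killed by `C(T, -)`. -/
def ghost : Submodule k (X ⟶ Y) :=
  LinearMap.ker ((preadditiveCoyonedaObj T).mapLinearMap k)

variable {k}

lemma mem_ghost_iff {a : X ⟶ Y} : a ∈ ghost k T X Y ↔ ∀ t : T ⟶ X, t ≫ a = 0 :=
  LinearMap.mem_ker.trans ⟨fun h t => ConcreteCategory.congr_hom h t,
    fun h => ModuleCat.hom_ext (LinearMap.ext h)⟩

lemma finrank_ghost_map (G : C ⥤ C) [G.Linear k] [G.Full] [G.Faithful] [G.Additive] (X Y : C) :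
    Module.finrank k (ghost k (G.obj T) (G.obj X) (G.obj Y)) =
      Module.finrank k (ghost k T X Y) := by
  have h : (ghost k T X Y).map (G.mapLinearMap k) = ghost k (G.obj T) (G.obj X) (G.obj Y) := by
    ext a
    obtain ⟨a, rfl⟩ := G.map_surjective a
    constructor
    · rintro ⟨b, hb, hba⟩
      rw [← hba, mem_ghost_iff]
      intro t
      obtain ⟨t, rfl⟩ := G.map_surjective t
      rw [Functor.coe_mapLinearMap, ← G.map_comp, mem_ghost_iff.1 hb t, G.map_zero]
    · intro ha
      refine ⟨a, mem_ghost_iff.2 fun t => G.map_injective ?_, rfl⟩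
      rw [G.map_comp, mem_ghost_iff.1 ha (G.map t), G.map_zero]
  rw [← h]
  exact (Submodule.equivMapOfInjective _ G.map_injective _).finrank_eq.symm

lemma finrank_hom_map (G : C ⥤ C) [G.Additive] [G.Linear k] [G.Full] [G.Faithful] (X Y : C) :
    Module.finrank k (G.obj X ⟶ G.obj Y) = Module.finrank k (X ⟶ Y) :=
  (LinearEquiv.ofBijective (G.mapLinearMap k) ⟨G.map_injective, G.map_surjective⟩).finrank_eq.symm

/-- The morphism `C(T, T) ⟶ N` with value `x` at the identity. -/
def homOfElem {N : ModuleCat.{v} (End T)ᵐᵒᵖ} (x : N) : (preadditiveCoyonedaObj T).obj T ⟶ N :=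
  ModuleCat.ofHom (LinearMap.toSpanSingleton (End T)ᵐᵒᵖ N x ∘ₗ
    { toFun := fun t => MulOpposite.op (t : End T)
      map_add' := fun _ _ => rfl
      map_smul' := fun _ _ => rfl })

lemma homOfElem_id {N : ModuleCat.{v} (End T)ᵐᵒᵖ} (x : N) :
    (homOfElem x).hom (𝟙 T) = x :=
  one_smul _ x

lemma hom_comp_eq_smul {N : ModuleCat.{v} (End T)ᵐᵒᵖ} (φ : (preadditiveCoyonedaObj T).obj X ⟶ N)
    (s : T ⟶ T) (t : T ⟶ X) : φ.hom (s ≫ t : T ⟶ X) = MulOpposite.op (s : End T) • φ.hom t :=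
  φ.hom.map_smul (MulOpposite.op (s : End T)) t

lemma hom_coyonedaObj_ext {N : ModuleCat.{v} (End T)ᵐᵒᵖ}
    {φ ψ : (preadditiveCoyonedaObj T).obj T ⟶ N} (h : φ.hom (𝟙 T) = ψ.hom (𝟙 T)) : φ = ψ := by
  refine ModuleCat.hom_ext (LinearMap.ext fun t : T ⟶ T => ?_)
  rw [← Category.comp_id t, hom_comp_eq_smul, hom_comp_eq_smul, h]

instance projective_coyonedaObj_self (T : C) : Projective ((preadditiveCoyonedaObj T).obj T) where
  factors {E N} φ e he := by
    obtain ⟨x, hx⟩ := (ModuleCat.epi_iff_surjective e).1 he (φ.hom (𝟙 T))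
    exact ⟨homOfElem x, hom_coyonedaObj_ext <| (congrArg e.hom (homOfElem_id x)).trans hx⟩

lemma epi_biproduct_desc_homOfElem {N : ModuleCat.{v} (End T)ᵐᵒᵖ} {n : ℕ} {x : Fin n → N}
    (hx : Submodule.span (End T)ᵐᵒᵖ (Set.range x) = ⊤) :
    Epi (biproduct.desc fun i => homOfElem (x i)) := by
  rw [ModuleCat.epi_iff_range_eq_top, eq_top_iff, ← hx, Submodule.span_le]
  rintro _ ⟨i, rfl⟩
  refine ⟨(biproduct.ι (fun _ => (preadditiveCoyonedaObj T).obj T) i).hom (𝟙 T), ?_⟩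
  rw [← homOfElem_id (x i), ← biproduct.ι_desc (fun i => homOfElem (x i)) i]
  rfl

variable [HasFiniteBiproducts C]

lemma exists_epi_coyonedaObj_biproduct (N : ModuleCat.{v} (End T)ᵐᵒᵖ)
    [Module.Finite (End T)ᵐᵒᵖ N] :
    ∃ (n : ℕ) (φ : (preadditiveCoyonedaObj T).obj (⨁ fun _ : Fin n => T) ⟶ N), Epi φ := by
  obtain ⟨n, x, hx⟩ := Module.Finite.exists_fin (R := (End T)ᵐᵒᵖ) (M := N)
  have := epi_biproduct_desc_homOfElem hx
  exact ⟨n, ((preadditiveCoyonedaObj T).mapBiproduct _).hom ≫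
    biproduct.desc fun i => homOfElem (x i), inferInstance⟩

variable [HasBinaryBiproducts C] {P : C}

lemma InAdd.projective_coyonedaObj (h : InAdd T P) :
    Projective ((preadditiveCoyonedaObj T).obj P) :=
  (h.map (preadditiveCoyonedaObj T)).projective

lemma InAdd.map_coyonedaObj_bijective (hP : InAdd T P) (Y : C) :
    Function.Bijective fun a : P ⟶ Y => (preadditiveCoyonedaObj T).map a := by
  let G := preadditiveCoyonedaObj T
  constructor
  · refine (injective_iff_map_eq_zero G.mapAddHom).2 fun a ha => ?_
    simpa using hP.comp_eq_zero (fun t => ConcreteCategory.congr_hom ha t) (𝟙 P)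
  · intro φ
    obtain ⟨n, p, q, hpq⟩ := hP.exists_sum_comp_eq_id
    let y (i : Fin n) : T ⟶ Y := φ.hom (q i)
    have map_y (i : Fin n) : G.map (y i) = G.map (q i) ≫ φ :=
      hom_coyonedaObj_ext <|
        (Category.id_comp _).trans (congrArg φ.hom (Category.id_comp (q i)).symm)
    refine ⟨∑ i, p i ≫ y i, ?_⟩
    calc
      G.map (∑ i, p i ≫ y i) = G.map (∑ i, p i ≫ q i) ≫ φ := by
        simp only [Functor.map_sum, Functor.map_comp, map_y, Preadditive.sum_comp,
          Category.assoc]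
      _ = φ := by rw [hpq, G.map_id, Category.id_comp]

end HomFunctor

section Abelian

variable (k : Type*) [Field k] {𝒜 : Type*} [Category* 𝒜] [Abelian 𝒜] [Linear k 𝒜]

lemma finrank_hom_of_shortExact {S : ShortComplex 𝒜} (hS : S.ShortExact) (P : 𝒜) [Projective P]
    [Module.Finite k (P ⟶ S.X₂)] :
    Module.finrank k (P ⟶ S.X₂) = Module.finrank k (P ⟶ S.X₁) + Module.finrank k (P ⟶ S.X₃) := by
  have := hS.mono_f
  have := hS.epi_g
  have f_injective : Function.Injective (Linear.rightComp k P S.f) :=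
    fun a b h => (cancel_mono S.f).1 h
  have g_surjective : Function.Surjective (Linear.rightComp k P S.g) :=
    fun a => ⟨Projective.factorThru a S.g, Projective.factorThru_comp a S.g⟩
  have exact : LinearMap.range (Linear.rightComp k P S.f) =
      LinearMap.ker (Linear.rightComp k P S.g) := by
    ext a
    constructor
    · rintro ⟨b, rfl⟩
      simp
    · exact fun ha => ⟨hS.exact.lift a ha, hS.exact.lift_f a ha⟩
  rw [← (Linear.rightComp k P S.g).finrank_range_add_finrank_ker, ← exact,
    LinearMap.finrank_range_of_inj f_injective,
    LinearMap.range_eq_top.2 g_surjective, finrank_top, add_comm]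

lemma range_leftComp {S : ShortComplex 𝒜} (hS : S.Exact) [Epi S.g] (M : 𝒜) :
    LinearMap.range (Linear.leftComp k M S.g) = LinearMap.ker (Linear.leftComp k M S.f) := by
  ext a
  constructor
  · rintro ⟨b, rfl⟩
    simp
  · exact fun ha => ⟨hS.desc a ha, hS.g_desc a ha⟩

variable [HasExt 𝒜]

lemma finrank_ext_add_finrank_range_leftComp {S : ShortComplex 𝒜} (hS : S.ShortExact)
    [Projective S.X₂] (M : 𝒜) [Module.Finite k (S.X₁ ⟶ M)] :
    Module.finrank k (Ext S.X₃ M 1) + Module.finrank k (LinearMap.range (Linear.leftComp k M S.f)) =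
      Module.finrank k (S.X₁ ⟶ M) := by
  let e {X : 𝒜} : Ext X M 0 ≃ₗ[k] (X ⟶ M) := Ext.linearEquiv₀
  let d : (S.X₁ ⟶ M) →ₗ[k] Ext S.X₃ M 1 :=
    Ext.precompOfLinear hS.extClass k M (a := 0) (b := 1) rfl ∘ₗ e.symm.toLinearMap
  have d_surjective : Function.Surjective d := fun x => by
    obtain ⟨y, hy⟩ :=
      Ext.contravariant_sequence_exact₃ hS M x (Ext.eq_zero_of_projective _) (n₀ := 0) rfl
    obtain ⟨a, rfl⟩ := e.symm.surjective y
    exact ⟨a, hy⟩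
  have ker_d : LinearMap.ker d = LinearMap.range (Linear.leftComp k M S.f) := by
    ext a
    constructor
    · intro ha
      obtain ⟨y, hy⟩ := Ext.contravariant_sequence_exact₁ hS M (Ext.mk₀ a) rfl ha
      obtain ⟨b, rfl⟩ := e.symm.surjective y
      exact ⟨b, e.symm.injective <| (Ext.mk₀_comp_mk₀ S.f b).symm.trans hy⟩
    · rintro ⟨b, rfl⟩
      change hS.extClass.comp (Ext.mk₀ (S.f ≫ b)) rfl = 0
      rw [← Ext.mk₀_comp_mk₀, hS.extClass_comp_assoc]
  rw [← d.finrank_range_add_finrank_ker, ker_d, LinearMap.range_eq_top.2 d_surjective, finrank_top]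

lemma finrank_ext_add_finrank_range_leftComp_of_exact {S : ShortComplex 𝒜} (hS : S.Exact) [Epi S.g]
    [Projective S.X₂] (M : 𝒜) [Module.Finite k (S.X₁ ⟶ M)] :
    Module.finrank k (Ext S.X₃ M 1) + Module.finrank k (LinearMap.range (Linear.leftComp k M S.f)) =
      Module.finrank k (LinearMap.ker (Linear.leftComp k M (kernel.ι S.f))) := by
  let K : ShortComplex 𝒜 := ShortComplex.mk _ _ (kernel.condition S.g)
  have hK : K.ShortExact := { exact := ShortComplex.exact_of_f_is_kernel _ (kernelIsKernel S.g) }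
  have : Projective K.X₂ := ‹Projective S.X₂›
  let π : S.X₁ ⟶ K.X₁ := kernel.lift S.g S.f S.zero
  have : Epi π := hS.epi_kernelLift
  have hπ : π ≫ K.f = S.f := kernel.lift_ι _ _ _
  have zero : kernel.ι S.f ≫ π = 0 := by
    have := hK.mono_f
    rw [← cancel_mono K.f, Category.assoc, hπ, kernel.condition, zero_comp]
  have π_exact : (ShortComplex.mk _ π zero).Exact :=
    ShortComplex.exact_of_f_is_kernel _ (isKernelOfComp K.f S.f (kernelIsKernel S.f) zero hπ)
  have π_injective : Function.Injective (Linear.leftComp k M π) := fun a b h => (cancel_epi π).1 h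
  have : Module.Finite k (K.X₁ ⟶ M) := Module.Finite.of_injective _ π_injective
  have range_f : LinearMap.range (Linear.leftComp k M S.f) =
      (LinearMap.range (Linear.leftComp k M K.f)).map (Linear.leftComp k M π) := by
    rw [← LinearMap.range_comp, ← hπ]
    congr 1
    ext a
    simp
  have hker := range_leftComp k π_exact M
  rw [range_f, ← hker, LinearMap.finrank_range_of_inj π_injective,
    ← finrank_ext_add_finrank_range_leftComp k hK M,
    (Submodule.equivMapOfInjective _ π_injective _).finrank_eq]

end Abelian

section Triangulated

variable {k : Type w} [Field k] {C : Type u} [Category.{v} C] [Preadditive C] [HasZeroObject C]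
  [HasShift C ℤ] [∀ n : ℤ, (shiftFunctor C n).Additive] [Pretriangulated C] {T X Y : C}

instance isHomological_preadditiveCoyonedaObj (T : C) :
    (preadditiveCoyonedaObj T).IsHomological where
  exact Δ hΔ := by
    rw [ShortComplex.moduleCat_exact_iff]
    intro (t : T ⟶ Δ.obj₂) ht
    obtain ⟨s, hs⟩ := Triangle.coyoneda_exact₂ Δ hΔ t ht
    exact ⟨s, hs.symm⟩

variable (T X) in
/-- A triangle `P₁ ⟶ P₀ ⟶ X ⟶ ΣP₁` exhibiting `P₀ ⟶ X` as a right `add T`-approximation whose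
cocone lies in `add T`; the approximation property is encoded as the vanishing of `C(T, δ)`. -/
structure AddPresentation where
  P₁ : C
  P₀ : C
  f : P₁ ⟶ P₀
  g : P₀ ⟶ X
  δ : X ⟶ P₁⟦(1 : ℤ)⟧
  distinguished : Triangle.mk f g δ ∈ distTriang C
  inAdd₁ : InAdd T P₁
  inAdd₀ : InAdd T P₀
  comp_δ : ∀ t : T ⟶ X, t ≫ δ = 0

namespace AddPresentation

variable (A : AddPresentation T X)

lemma f_comp_g : A.f ≫ A.g = 0 := comp_distTriang_mor_zero₁₂ _ A.distinguished

lemma δ_comp_f : A.δ ≫ A.f⟦(1 : ℤ)⟧' = 0 := comp_distTriang_mor_zero₃₁ _ A.distinguished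

lemma exists_lift (t : T ⟶ X) : ∃ t', t = t' ≫ A.g :=
  Triangle.coyoneda_exact₃ _ A.distinguished t (A.comp_δ t)

lemma exists_desc {u : A.P₀ ⟶ Y} (hu : A.f ≫ u = 0) : ∃ a : X ⟶ Y, u = A.g ≫ a :=
  Triangle.yoneda_exact₂ _ A.distinguished u hu

instance epi_map_g : Epi ((preadditiveCoyonedaObj T).map A.g) :=
  (ModuleCat.epi_iff_surjective _).2 fun t => (A.exists_lift t).imp fun _ h => h.symm

lemma exact_map : (ShortComplex.mk ((preadditiveCoyonedaObj T).map A.f)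
    ((preadditiveCoyonedaObj T).map A.g)
    (by rw [← Functor.map_comp, A.f_comp_g, Functor.map_zero])).Exact :=
  (preadditiveCoyonedaObj T).map_distinguished_exact _ A.distinguished

lemma map_surjective (A : AddPresentation T X) (Y : C) :
    Function.Surjective fun a : X ⟶ Y => (preadditiveCoyonedaObj T).map a := fun φ => by
  let G := preadditiveCoyonedaObj T
  obtain ⟨u, hu : G.map u = G.map A.g ≫ φ⟩ := (A.inAdd₀.map_coyonedaObj_bijective Y).2
    (G.map A.g ≫ φ)
  have f_comp_u : A.f ≫ u = 0 := (A.inAdd₁.map_coyonedaObj_bijective Y).1 <| by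
    dsimp only
    rw [Functor.map_comp, hu, ← Functor.map_comp_assoc, A.f_comp_g, Functor.map_zero, zero_comp,
      Functor.map_zero]
  obtain ⟨a, rfl⟩ := A.exists_desc f_comp_u
  exact ⟨a, by rw [← cancel_epi (G.map A.g), ← hu, Functor.map_comp]⟩

variable [Linear k C]

lemma mem_ghost_iff {a : X ⟶ Y} : a ∈ ghost k T X Y ↔ A.g ≫ a = 0 := by
  rw [TwoCY.mem_ghost_iff]
  refine ⟨fun h => A.inAdd₀.comp_eq_zero h A.g, fun h t => ?_⟩
  obtain ⟨t, rfl⟩ := A.exists_lift t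
  rw [Category.assoc, h, comp_zero]

lemma ker_leftComp_g : LinearMap.ker (Linear.leftComp k Y A.g) = ghost k T X Y := by
  ext a
  exact A.mem_ghost_iff.symm

lemma range_leftComp_g :
    LinearMap.range (Linear.leftComp k Y A.g) = LinearMap.ker (Linear.leftComp k Y A.f) := by
  ext u
  constructor
  · rintro ⟨a, rfl⟩
    change A.f ≫ A.g ≫ a = 0
    rw [← Category.assoc, A.f_comp_g, zero_comp]
  · exact fun h => (A.exists_desc h).imp fun _ h => h.symm

variable (k) in
lemma finrank_map_hom_add_finrank_ghost [∀ X Y : C, Module.Finite k (X ⟶ Y)]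
    (A : AddPresentation T X) (Y : C) :
    Module.finrank k ((F k T X).obj ⟶ (F k T Y).obj) + Module.finrank k (ghost k T X Y) =
      Module.finrank k (X ⟶ Y) := by
  let L : (X ⟶ Y) →ₗ[k] ((F k T X).obj ⟶ (F k T Y).obj) :=
    (preadditiveCoyonedaObj T).mapLinearMap k
  have range_L : LinearMap.range L = ⊤ := LinearMap.range_eq_top.2 (A.map_surjective Y)
  rw [← L.finrank_range_add_finrank_ker, range_L, finrank_top]
  rfl

lemma δ_comp_mem_ghost_shift_iff {u : A.P₁ ⟶ Y} :
    A.δ ≫ u⟦(1 : ℤ)⟧' ∈ ghost k (T⟦(1 : ℤ)⟧) X (Y⟦(1 : ℤ)⟧) ↔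
      ∀ t : T ⟶ A.P₁, t ≫ A.f = 0 → t ≫ u = 0 := by
  let S := shiftFunctor C (1 : ℤ)
  rw [TwoCY.mem_ghost_iff]
  constructor
  · intro h t ht
    obtain ⟨s, hs⟩ : ∃ s : T⟦(1 : ℤ)⟧ ⟶ X, S.map t = s ≫ A.δ :=
      Triangle.coyoneda_exact₁ _ A.distinguished (S.map t) <| by
        change S.map t ≫ S.map A.f = 0
        rw [← S.map_comp, ht, S.map_zero]
    apply S.map_injective
    rw [S.map_comp, hs, Category.assoc, h s, S.map_zero]
  · intro h s
    obtain ⟨t, ht⟩ := S.map_surjective (s ≫ A.δ)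
    have t_comp_f : t ≫ A.f = 0 := S.map_injective <| by
      rw [S.map_comp, ht, Category.assoc, A.δ_comp_f, comp_zero, S.map_zero]
    rw [← Category.assoc, ← ht, ← S.map_comp, h t t_comp_f, S.map_zero]

variable [(shiftFunctor C (1 : ℤ)).Linear k]

variable (k Y) in
/-- The map `C(P₁, Y) → C(X, ΣY)` of the long exact sequence of the triangle. -/
def connecting : (A.P₁ ⟶ Y) →ₗ[k] (X ⟶ Y⟦(1 : ℤ)⟧) :=
  Linear.leftComp k _ A.δ ∘ₗ (shiftFunctor C (1 : ℤ)).mapLinearMap k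

lemma connecting_apply (u : A.P₁ ⟶ Y) : A.connecting k Y u = A.δ ≫ u⟦(1 : ℤ)⟧' := rfl

lemma ker_connecting :
    LinearMap.ker (A.connecting k Y) = LinearMap.range (Linear.leftComp k Y A.f) := by
  let S := shiftFunctor C (1 : ℤ)
  ext u
  constructor
  · intro hu
    obtain ⟨b, hb⟩ : ∃ b : A.P₀⟦(1 : ℤ)⟧ ⟶ Y⟦(1 : ℤ)⟧, S.map u = (-S.map A.f) ≫ b :=
      Triangle.yoneda_exact₃ _ (rot_of_distTriang _ A.distinguished) (S.map u) hu
    obtain ⟨u₀, rfl⟩ := S.map_surjective b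
    refine ⟨-u₀, S.map_injective ?_⟩
    rw [hb, Linear.leftComp_apply, S.map_comp, S.map_neg, Preadditive.comp_neg,
      Preadditive.neg_comp]
  · rintro ⟨u₀, rfl⟩
    change A.δ ≫ S.map (A.f ≫ u₀) = 0
    rw [S.map_comp, ← Category.assoc, A.δ_comp_f, zero_comp]

lemma range_connecting : LinearMap.range (A.connecting k Y) = ghost k T X (Y⟦(1 : ℤ)⟧) := by
  ext a
  constructor
  · rintro ⟨u, rfl⟩
    rw [TwoCY.mem_ghost_iff]
    intro t
    rw [connecting_apply, ← Category.assoc, A.comp_δ, zero_comp]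
  · intro ha
    obtain ⟨b, rfl⟩ := Triangle.yoneda_exact₃ _ A.distinguished a (A.mem_ghost_iff.1 ha)
    obtain ⟨u, rfl⟩ := (shiftFunctor C (1 : ℤ)).map_surjective b
    exact ⟨u, rfl⟩

-- The Euler characteristic of
-- `0 → ghost(X, Y) → C(X, Y) → C(P₀, Y) → C(P₁, Y) → ghost(X, ΣY) → 0`.
variable (k) in
lemma finrank_hom_add_finrank_hom [∀ X Y : C, Module.Finite k (X ⟶ Y)] (Y : C) :
    Module.finrank k (X ⟶ Y) + Module.finrank k (A.P₁ ⟶ Y) =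
      Module.finrank k (ghost k T X Y) + Module.finrank k (A.P₀ ⟶ Y) +
        Module.finrank k (ghost k T X (Y⟦(1 : ℤ)⟧)) := by
  have at_X := (Linear.leftComp k Y A.g).finrank_range_add_finrank_ker
  have at_P₀ := (Linear.leftComp k Y A.f).finrank_range_add_finrank_ker
  have at_P₁ := (A.connecting k Y).finrank_range_add_finrank_ker
  rw [A.ker_leftComp_g, A.range_leftComp_g] at at_X
  rw [A.range_connecting, A.ker_connecting] at at_P₁
  omega

end AddPresentation

end Triangulated

section Ext

lemma kernel_ι_comp_eq_zero_iff {R : Type*} [Ring R] {L M N : ModuleCat.{v} R} (f : L ⟶ M)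
    (g : L ⟶ N) : kernel.ι f ≫ g = 0 ↔ ∀ x, f.hom x = 0 → g.hom x = 0 := by
  constructor
  · intro h x hx
    have exact : (ShortComplex.mk _ f (kernel.condition f)).Exact :=
      ShortComplex.exact_of_f_is_kernel _ (kernelIsKernel f)
    obtain ⟨z, rfl⟩ := (ShortComplex.moduleCat_exact_iff _).1 exact x hx
    exact ConcreteCategory.congr_hom h z
  · intro h
    ext z
    exact h _ (ConcreteCategory.congr_hom (kernel.condition f) z)

variable {k : Type w} [Field k] {C : Type u} [Category.{v} C] [Preadditive C] [Linear k C]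
  [HasZeroObject C] [HasShift C ℤ] [∀ n : ℤ, (shiftFunctor C n).Additive] [Pretriangulated C]
  {T X : C}

namespace AddPresentation

variable (A : AddPresentation T X) (Y : C)

variable (k) in
lemma map_range_leftComp_f :
    (LinearMap.range (Linear.leftComp k Y A.f)).map ((preadditiveCoyonedaObj T).mapLinearMap k) =
      LinearMap.range (Linear.leftComp k ((preadditiveCoyonedaObj T).obj Y)
        ((preadditiveCoyonedaObj T).map A.f)) := by
  let G := preadditiveCoyonedaObj T
  ext φ
  constructor
  · rintro ⟨_, ⟨a, rfl⟩, rfl⟩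
    exact ⟨G.map a, (G.map_comp A.f a).symm⟩
  · rintro ⟨b, rfl⟩
    obtain ⟨a, rfl⟩ := (A.inAdd₀.map_coyonedaObj_bijective Y).2 b
    exact ⟨A.f ≫ a, ⟨a, rfl⟩, G.map_comp A.f a⟩

variable [(shiftFunctor C (1 : ℤ)).Linear k]

variable (k) in
lemma map_comap_connecting_ghost :
    ((ghost k (T⟦(1 : ℤ)⟧) X (Y⟦(1 : ℤ)⟧)).comap (A.connecting k Y)).map
        ((preadditiveCoyonedaObj T).mapLinearMap k) =
      LinearMap.ker (Linear.leftComp k ((preadditiveCoyonedaObj T).obj Y)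
        (kernel.ι ((preadditiveCoyonedaObj T).map A.f))) := by
  let G := preadditiveCoyonedaObj T
  have mem_iff (u : A.P₁ ⟶ Y) : u ∈ (ghost k (T⟦(1 : ℤ)⟧) X (Y⟦(1 : ℤ)⟧)).comap
      (A.connecting k Y) ↔ kernel.ι (G.map A.f) ≫ G.map u = 0 := by
    rw [kernel_ι_comp_eq_zero_iff]
    exact A.δ_comp_mem_ghost_shift_iff
  ext φ
  obtain ⟨u, rfl⟩ := (A.inAdd₁.map_coyonedaObj_bijective Y).2 φ
  refine ⟨?_, fun h => ⟨u, (mem_iff u).2 h, rfl⟩⟩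
  rintro ⟨u', hu', hu'u⟩
  exact hu'u ▸ (mem_iff u').1 hu'

variable (k) in
lemma finrank_ext [∀ X Y : C, Module.Finite k (X ⟶ Y)] (A : AddPresentation T X) :
    Module.finrank k (Ext (F k T X).obj (F k T Y).obj 1) =
      Module.finrank k ↥(ghost k T X (Y⟦(1 : ℤ)⟧) ⊓ ghost k (T⟦(1 : ℤ)⟧) X (Y⟦(1 : ℤ)⟧)) := by
  let G := preadditiveCoyonedaObj T
  let d := A.connecting k Y
  let K := (ghost k (T⟦(1 : ℤ)⟧) X (Y⟦(1 : ℤ)⟧)).comap d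
  have map_K : K.map d = ghost k T X (Y⟦(1 : ℤ)⟧) ⊓ ghost k (T⟦(1 : ℤ)⟧) X (Y⟦(1 : ℤ)⟧) := by
    rw [Submodule.map_comap_eq, A.range_connecting]
  have finrank_map (L : Submodule k (A.P₁ ⟶ Y)) :
      Module.finrank k (L.map (G.mapLinearMap k)) = Module.finrank k L :=
    (Submodule.equivMapOfInjective _ (A.inAdd₁.map_coyonedaObj_bijective Y).1 L).finrank_eq.symm
  have in_C := finrank_map_add_finrank_ker d (A := K) (LinearMap.ker_le_comap _)
  have : Projective (G.obj A.P₀) := A.inAdd₀.projective_coyonedaObj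
  have : Module.Finite k (G.obj A.P₁ ⟶ G.obj Y) := finiteHom (F k T A.P₁) (F k T Y)
  have in_mod := finrank_ext_add_finrank_range_leftComp_of_exact k A.exact_map (G.obj Y)
  rw [map_K, A.ker_connecting, ← finrank_map, ← finrank_map K, A.map_comap_connecting_ghost k,
    A.map_range_leftComp_f k] at in_C
  exact Nat.add_right_cancel (in_mod.trans in_C.symm)

end AddPresentation

end Ext

section CalabiYau

variable {k : Type w} [Field k] {C : Type u} [Category.{v} C] [Preadditive C] [Linear k C]

lemma IsTwoCalabiYau.hom_eq_zero [HasShift C ℤ] (hCY : IsTwoCalabiYau k C) {X Y : C}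
    (h : ∀ f : X ⟶ Y⟦(1 : ℤ)⟧, f = 0) (f : Y ⟶ X⟦(1 : ℤ)⟧) : f = 0 := by
  obtain ⟨φ, -⟩ := hCY
  refine (φ Y X).injective (LinearMap.ext fun g => ?_)
  rw [h g, map_zero, map_zero]

variable [HasZeroObject C] [HasShift C ℤ] [∀ n : ℤ, (shiftFunctor C n).Additive]
  [Pretriangulated C] {T U V X P : C}

lemma InAdd.hom_shift_eq_zero (hP : InAdd T P) (rigid : ∀ f : T ⟶ T⟦(1 : ℤ)⟧, f = 0)
    (t : T ⟶ P⟦(1 : ℤ)⟧) : t = 0 :=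
  (hP.map (shiftFunctor C (1 : ℤ))).hom_eq_zero rigid t

lemma IsTwoCalabiYau.exists_dual_equiv [(shiftFunctor C (1 : ℤ)).Linear k]
    (hCY : IsTwoCalabiYau k C) (X Y : C) :
    ∃ φ : (X ⟶ Y⟦(1 : ℤ)⟧) ≃ₗ[k] Module.Dual k (Y ⟶ X⟦(1 : ℤ)⟧),
      ∀ {U : C}, (∀ f : U ⟶ U⟦(1 : ℤ)⟧, f = 0) → AddPresentation U X →
        ((ghost k U X (Y⟦(1 : ℤ)⟧)).map φ.toLinearMap).dualCoannihilator =
          ghost k U Y (X⟦(1 : ℤ)⟧) := by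
  obtain ⟨φ, hφ⟩ := hCY
  have natural {Z W : C} (h : Z ⟶ W) (a : X ⟶ Z⟦(1 : ℤ)⟧) (b : W ⟶ X⟦(1 : ℤ)⟧) :
      φ X W (a ≫ h⟦(1 : ℤ)⟧') b = φ X Z a (h ≫ b) := by
    simpa using hφ (𝟙 X) h a b
  refine ⟨φ X Y, fun {U} rigid A => ?_⟩
  ext b
  rw [Submodule.mem_dualCoannihilator, mem_ghost_iff]
  constructor
  · intro h t
    rw [← Module.forall_dual_apply_eq_zero_iff k]
    intro ψ
    obtain ⟨c, rfl⟩ := (φ X U).surjective ψ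
    have c_ghost : c ≫ t⟦(1 : ℤ)⟧' ∈ ghost k U X (Y⟦(1 : ℤ)⟧) :=
      mem_ghost_iff.2 fun s => by rw [← Category.assoc, rigid (s ≫ c), zero_comp]
    rw [← natural]
    exact h _ (Submodule.mem_map_of_mem c_ghost)
  · rintro h _ ⟨a, ha, rfl⟩
    obtain ⟨u, rfl⟩ := A.range_connecting.ge ha
    exact (natural u A.δ b).trans <| by rw [A.inAdd₁.comp_eq_zero h u, map_zero]

variable [∀ X Y : C, Module.Finite k (X ⟶ Y)]

namespace IsTwoCalabiYau

variable [(shiftFunctor C (1 : ℤ)).Linear k]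

lemma finrank_ghost_sup_add_finrank_ghost_inf (hCY : IsTwoCalabiYau k C)
    (hU : ∀ f : U ⟶ U⟦(1 : ℤ)⟧, f = 0) (hV : ∀ f : V ⟶ V⟦(1 : ℤ)⟧, f = 0)
    (A : AddPresentation U X) (A' : AddPresentation V X) (Y : C) :
    Module.finrank k ↥(ghost k U X (Y⟦(1 : ℤ)⟧) ⊔ ghost k V X (Y⟦(1 : ℤ)⟧)) +
        Module.finrank k ↥(ghost k U Y (X⟦(1 : ℤ)⟧) ⊓ ghost k V Y (X⟦(1 : ℤ)⟧)) =
      Module.finrank k (X ⟶ Y⟦(1 : ℤ)⟧) := by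
  obtain ⟨φ, hφ⟩ := hCY.exists_dual_equiv X Y
  rw [← hφ hU A, ← hφ hV A', ← Submodule.dualCoannihilator_sup_eq, ← Submodule.map_sup]
  exact finrank_add_finrank_dualCoannihilator_map φ _

lemma finrank_ghost_add_finrank_ghost (hCY : IsTwoCalabiYau k C)
    (rigid : ∀ f : T ⟶ T⟦(1 : ℤ)⟧, f = 0) (A : AddPresentation T X) (Y : C) :
    Module.finrank k (ghost k T X (Y⟦(1 : ℤ)⟧)) + Module.finrank k (ghost k T Y (X⟦(1 : ℤ)⟧)) =
      Module.finrank k (X ⟶ Y⟦(1 : ℤ)⟧) := by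
  have h := hCY.finrank_ghost_sup_add_finrank_ghost_inf rigid rigid A A Y
  rwa [sup_idem, inf_idem] at h

end IsTwoCalabiYau

instance finite_op_obj {B : Type v} [Ring B] [Algebra k B] (N : FDMod k B) :
    Module.Finite Bᵐᵒᵖ N.obj :=
  Module.Finite.of_restrictScalars_finite k _ _

lemma IsClusterTilting.nonempty_addPresentation (hT : IsClusterTilting T)
    (hCY : IsTwoCalabiYau k C) (X : C) : Nonempty (AddPresentation T X) := by
  let G := preadditiveCoyonedaObj T
  obtain ⟨n, p, hp⟩ := exists_epi_coyonedaObj_biproduct (F k T X).obj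
  obtain ⟨g, rfl⟩ := ((inAdd_biproduct T n).map_coyonedaObj_bijective X).2 p
  have exists_lift : ∀ t : T ⟶ X, ∃ t', t' ≫ g = t := (ModuleCat.epi_iff_surjective (G.map g)).1 hp
  obtain ⟨P₁, f, δ, hd⟩ := distinguished_cocone_triangle₁ g
  have comp_δ (t : T ⟶ X) : t ≫ δ = 0 := by
    obtain ⟨t', rfl⟩ := exists_lift t
    rw [Category.assoc, show g ≫ δ = 0 from comp_distTriang_mor_zero₂₃ _ hd, comp_zero]
  have P₁_rigid (a : T ⟶ P₁⟦(1 : ℤ)⟧) : a = 0 := by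
    obtain ⟨b, rfl⟩ := Triangle.coyoneda_exact₁ _ hd a
      ((inAdd_biproduct T n).hom_shift_eq_zero hT.rigid _)
    exact comp_δ b
  exact ⟨⟨P₁, _, f, g, δ, hd, hT.mem_add _ (hCY.hom_eq_zero P₁_rigid), inAdd_biproduct T n, comp_δ⟩⟩

lemma exists_iso_F (rigid : ∀ f : T ⟶ T⟦(1 : ℤ)⟧, f = 0) (N : FDMod k (End T)) :
    ∃ X : C, Nonempty (N ≅ F k T X) := by
  obtain ⟨n₀, p, hp⟩ := exists_epi_coyonedaObj_biproduct N.obj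
  have kernel_isFD : isFD k (End T) (kernel p) :=
    finite_of_injective (hN := (F k T (⨁ fun _ : Fin n₀ => T)).property) (kernel.ι p)
      ((ModuleCat.mono_iff_injective (kernel.ι p)).1 inferInstance)
  have : Module.Finite (End T)ᵐᵒᵖ ↑(kernel p) := finite_op_obj ⟨kernel p, kernel_isFD⟩
  obtain ⟨n₁, q, hq⟩ := exists_epi_coyonedaObj_biproduct (kernel p)
  obtain ⟨f, hf⟩ := ((inAdd_biproduct T n₁).map_coyonedaObj_bijective _).2 (q ≫ kernel.ι p)
  obtain ⟨X, g, δ, hd⟩ := distinguished_cocone_triangle f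
  let A : AddPresentation T X :=
    ⟨_, _, f, g, δ, hd, inAdd_biproduct T n₁, inAdd_biproduct T n₀,
      fun _ => (inAdd_biproduct T n₁).hom_shift_eq_zero rigid _⟩
  have := A.epi_map_g
  have p_exact := ShortComplex.exact_of_f_is_kernel
    (ShortComplex.mk _ p (kernel.condition p)) (kernelIsKernel p)
  have p_cokernel := isCokernelEpiComp p_exact.gIsCokernel q hf
  exact ⟨X, ⟨(isFD k (End T)).isoMk (p_cokernel.coconePointUniqueUpToIso A.exact_map.gIsCokernel)⟩⟩

lemma exists_iso_F_shift (rigid : ∀ f : T ⟶ T⟦(1 : ℤ)⟧, f = 0) (N : FDMod k (End T)) :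
    ∃ X : C, Nonempty (N ≅ F k T (X⟦(1 : ℤ)⟧)) := by
  obtain ⟨X, ⟨e⟩⟩ := exists_iso_F rigid N
  let i : X ≅ (X⟦(-1 : ℤ)⟧)⟦(1 : ℤ)⟧ := (shiftFunctorCompIsoId C (-1 : ℤ) 1 (by simp)).symm.app X
  exact ⟨X⟦(-1 : ℤ)⟧, ⟨e ≪≫ (isFD k (End T)).isoMk ((preadditiveCoyonedaObj T).mapIso i)⟩⟩

end CalabiYau

section Index

variable {k : Type w} [Field k] {C : Type u} [Category.{v} C] [Preadditive C] [Linear k C]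
  [∀ X Y : C, Module.Finite k (X ⟶ Y)] [HasZeroObject C] [HasShift C ℤ]
  [∀ n : ℤ, (shiftFunctor C n).Additive] [Pretriangulated C] {T X : C}

namespace AddPresentation

/-- The pairing of the index `[P₀] - [P₁]` of `X` with a module `M`, the classes in `add T` being
paired with `M` through `P ↦ dim Hom(C(T, P), M)`. -/
def index (A : AddPresentation T X) (M : FDMod k (End T)) : ℤ :=
  (Module.finrank k ((F k T A.P₀).obj ⟶ M.obj) : ℤ) -
    Module.finrank k ((F k T A.P₁).obj ⟶ M.obj)

variable (A : AddPresentation T X)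

lemma index_congr {M N : FDMod k (End T)} (e : M ≅ N) : A.index M = A.index N := by
  have finrank_eq (P : FDMod k (End T)) :
      Module.finrank k (P.obj ⟶ M.obj) = Module.finrank k (P.obj ⟶ N.obj) :=
    (Linear.homCongr k (Iso.refl P.obj) ((isFD k (End T)).ι.mapIso e)).finrank_eq
  rw [index, index, finrank_eq, finrank_eq]

lemma index_F (Y : C) :
    A.index (F k T Y) = (Module.finrank k (A.P₀ ⟶ Y) : ℤ) - Module.finrank k (A.P₁ ⟶ Y) := by
  have finrank_eq {P : C} (hP : InAdd T P) :
      Module.finrank k ((F k T P).obj ⟶ (F k T Y).obj) = Module.finrank k (P ⟶ Y) :=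
    (LinearEquiv.ofBijective ((preadditiveCoyonedaObj T).mapLinearMap k)
      (hP.map_coyonedaObj_bijective Y)).finrank_eq.symm
  rw [index, finrank_eq A.inAdd₀, finrank_eq A.inAdd₁]

lemma index_eq_add {L M N : FDMod k (End T)} {f : L.obj ⟶ M.obj} {g : M.obj ⟶ N.obj}
    {h : f ≫ g = 0} (hS : (ShortComplex.mk f g h).ShortExact) :
    A.index M = A.index L + A.index N := by
  have : Projective (F k T A.P₀).obj := A.inAdd₀.projective_coyonedaObj
  have : Projective (F k T A.P₁).obj := A.inAdd₁.projective_coyonedaObj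
  have at_P₀ := finrank_hom_of_shortExact k hS (F k T A.P₀).obj
  have at_P₁ := finrank_hom_of_shortExact k hS (F k T A.P₁).obj
  rw [index, index, index, at_P₀, at_P₁]
  push_cast
  ring

end AddPresentation

variable [(shiftFunctor C (1 : ℤ)).Linear k]

namespace IsClusterTilting

lemma finrank_ext_add_finrank_ghost_add_finrank_ghost (hT : IsClusterTilting T)
    (hCY : IsTwoCalabiYau k C) (X Y : C) :
    Module.finrank k (Ext (F k T Y).obj (F k T X).obj 1) +
        Module.finrank k (ghost k T X (Y⟦(1 : ℤ)⟧)) +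
        Module.finrank k (ghost k (T⟦(1 : ℤ)⟧) X (Y⟦(1 : ℤ)⟧)) =
      Module.finrank k (Ext (F k T X).obj (F k T Y).obj 1) +
        Module.finrank k (X ⟶ Y⟦(1 : ℤ)⟧) := by
  obtain ⟨A⟩ := hT.nonempty_addPresentation hCY X
  obtain ⟨A'⟩ := hT.shift.nonempty_addPresentation hCY X
  obtain ⟨AY⟩ := hT.nonempty_addPresentation hCY Y
  have duality :=
    hCY.finrank_ghost_sup_add_finrank_ghost_inf hT.rigid hT.shift.rigid A A' Y
  have modular := Submodule.finrank_sup_add_finrank_inf_eq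
    (ghost k T X (Y⟦(1 : ℤ)⟧)) (ghost k (T⟦(1 : ℤ)⟧) X (Y⟦(1 : ℤ)⟧))
  rw [AY.finrank_ext k X, A.finrank_ext k Y]
  omega

lemma pairing_F_sub_pairing_F (hT : IsClusterTilting T) (hCY : IsTwoCalabiYau k C)
    (A : AddPresentation T (X⟦(1 : ℤ)⟧)) (A' : AddPresentation T X) (Y : C) :
    pairing (F k T (X⟦(1 : ℤ)⟧)) (F k T Y) - pairing (F k T Y) (F k T (X⟦(1 : ℤ)⟧)) =
      A.index (F k T Y) + A'.index (F k T Y) := by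
  obtain ⟨AY⟩ := hT.nonempty_addPresentation hCY Y
  have hom_shift_Y := A.finrank_map_hom_add_finrank_ghost k Y
  have hom_Y_shift := AY.finrank_map_hom_add_finrank_ghost k (X⟦(1 : ℤ)⟧)
  have ext := hT.finrank_ext_add_finrank_ghost_add_finrank_ghost hCY (X⟦(1 : ℤ)⟧) Y
  rw [finrank_hom_map, finrank_ghost_map] at ext
  have euler_shift := A.finrank_hom_add_finrank_hom k Y
  have euler_X := A'.finrank_hom_add_finrank_hom k Y
  have duality_XY := hCY.finrank_ghost_add_finrank_ghost hT.rigid A' Y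
  have duality_YX := hCY.finrank_ghost_add_finrank_ghost hT.rigid AY X
  rw [pairing, pairing, A.index_F, A'.index_F]
  omega

lemma exists_formA_mk_eq_index_add_index (hT : IsClusterTilting T) (hCY : IsTwoCalabiYau k C)
    (N : FDMod k (End T)) :
    ∃ (X : C) (A : AddPresentation T (X⟦(1 : ℤ)⟧)) (A' : AddPresentation T X),
      ∀ M : FDMod k (End T),
        formA k (End T) (K0sp.mk N) (K0sp.mk M) = A.index M + A'.index M := by
  obtain ⟨X, ⟨e⟩⟩ := exists_iso_F_shift hT.rigid N
  obtain ⟨A⟩ := hT.nonempty_addPresentation hCY (X⟦(1 : ℤ)⟧)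
  obtain ⟨A'⟩ := hT.nonempty_addPresentation hCY X
  refine ⟨X, A, A', fun M => ?_⟩
  obtain ⟨Y, ⟨i⟩⟩ := exists_iso_F hT.rigid M
  rw [formA_mk, pairing_congr e i, pairing_congr i e, hT.pairing_F_sub_pairing_F hCY A A',
    A.index_congr i, A'.index_congr i]

lemma isExactAdditive_formA_flip (hT : IsClusterTilting T) (hCY : IsTwoCalabiYau k C) :
    IsExactAdditive (formA k (End T)).flip := fun hS => K0sp.hom_ext fun N => by
  obtain ⟨X, A, A', hN⟩ := hT.exists_formA_mk_eq_index_add_index hCY N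
  simp only [AddMonoidHom.add_apply, AddMonoidHom.flip_apply, hN]
  rw [A.index_eq_add hS, A'.index_eq_add hS]
  ring

lemma isExactAdditive_formA (hT : IsClusterTilting T) (hCY : IsTwoCalabiYau k C) :
    IsExactAdditive (formA k (End T)) := fun hS => by
  have h := hT.isExactAdditive_formA_flip hCY hS
  rw [formA_flip] at h
  simp only [AddMonoidHom.neg_apply] at h
  rw [← neg_inj, h, neg_add]

end IsClusterTilting

end Index

end TwoCY

end

theorem theorem3p3_general {k : Type w} [Field k]
    {C : Type u} [Category.{v} C] [Preadditive C] [Linear k C] [HasZeroObject C]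
    [HasShift C ℤ] [∀ n : ℤ, (shiftFunctor C n).Additive] [(shiftFunctor C (1 : ℤ)).Linear k]
    [Pretriangulated C] [∀ X Y : C, Module.Finite k (X ⟶ Y)]
    (hCY : TwoCY.IsTwoCalabiYau k C) (T : C) (hT : TwoCY.IsClusterTilting T) :
    (∃ β : TwoCY.K0 k (End T) →+ TwoCY.K0 k (End T) →+ ℤ,
      (∀ x y : TwoCY.K0sp k (End T),
        β (TwoCY.toK0 k (End T) x) (TwoCY.toK0 k (End T) y) =
          TwoCY.formA k (End T) x y) ∧
      (∀ x y : TwoCY.K0 k (End T), β x y = -β y x) ∧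
      ∀ β' : TwoCY.K0 k (End T) →+ TwoCY.K0 k (End T) →+ ℤ,
        (∀ x y : TwoCY.K0sp k (End T),
          β' (TwoCY.toK0 k (End T) x) (TwoCY.toK0 k (End T) y) =
            TwoCY.formA k (End T) x y) → β' = β) ∧
    ∀ x : TwoCY.K0sp k (End T),
      ∃! l : TwoCY.K0 k (End T) →+ ℤ, ∀ y : TwoCY.K0sp k (End T),
        l (TwoCY.toK0 k (End T) y) = TwoCY.formA k (End T) x y := by
  let β := TwoCY.K0.lift₂ (TwoCY.formA k (End T))
    (hT.isExactAdditive_formA hCY) (hT.isExactAdditive_formA_flip hCY)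
  have hβ : ∀ x y, β (TwoCY.toK0 k (End T) x) (TwoCY.toK0 k (End T) y) =
      TwoCY.formA k (End T) x y := TwoCY.K0.lift₂_toK0 _ _ _
  refine ⟨⟨β, hβ, fun x y => ?_, fun β' hβ' => ?_⟩, fun x => ?_⟩
  · obtain ⟨x, rfl⟩ := TwoCY.toK0_surjective x
    obtain ⟨y, rfl⟩ := TwoCY.toK0_surjective y
    rw [hβ, hβ, ← AddMonoidHom.flip_apply, TwoCY.formA_flip]
    simp
  · exact TwoCY.K0.hom_ext₂ fun x y => (hβ' x y).trans (hβ x y).symm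
  · exact ⟨β (TwoCY.toK0 k (End T) x), hβ x,
      fun l hl => TwoCY.K0.hom_ext fun y => (hl y).trans (hβ x y).symm⟩

theorem theorem3p3 {k : Type w} [Field k] [IsAlgClosed k]
    {C : Type u} [Category.{v} C] [Preadditive C] [Linear k C] [HasZeroObject C]
    [HasShift C ℤ] [∀ n : ℤ, (shiftFunctor C n).Additive]
    [∀ n : ℤ, (shiftFunctor C n).Linear k]
    [Pretriangulated C] [IsTriangulated C] [IsIdempotentComplete C]
    [∀ X Y : C, Module.Finite k (X ⟶ Y)]
    (hCY : TwoCY.IsTwoCalabiYau k C) (T : C) (hT : TwoCY.IsClusterTilting T) :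
    (∃ β : TwoCY.K0 k (End T) →+ TwoCY.K0 k (End T) →+ ℤ,
      (∀ x y : TwoCY.K0sp k (End T),
        β (TwoCY.toK0 k (End T) x) (TwoCY.toK0 k (End T) y) =
          TwoCY.formA k (End T) x y) ∧
      (∀ x y : TwoCY.K0 k (End T), β x y = -β y x) ∧
      ∀ β' : TwoCY.K0 k (End T) →+ TwoCY.K0 k (End T) →+ ℤ,
        (∀ x y : TwoCY.K0sp k (End T),
          β' (TwoCY.toK0 k (End T) x) (TwoCY.toK0 k (End T) y) =
            TwoCY.formA k (End T) x y) → β' = β) ∧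
    ∀ X : C, Indecomposable X → TwoCY.IsSummand X T →
      ∃! l : TwoCY.K0 k (End T) →+ ℤ, ∀ y : TwoCY.K0sp k (End T),
        l (TwoCY.toK0 k (End T) y) =
          TwoCY.formA k (End T) (TwoCY.K0sp.mk (TwoCY.top (TwoCY.F k T X))) y :=
  (theorem3p3_general hCY T hT).imp_right fun h _ _ _ => h _
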